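/- \textbf{Theorem (Approximation guarantee).} There are an absolute constant $C$ and a randomized algorithm with the following property. The algorithm receives a ground set $\mathcal N$ of $n\ge 0$ elements (without loss of generality $\mathcal N=\{0,\dots,n-1\}$), an integer $k\ge 1$, and value-oracle access to a function $f\colon 2^{\mathcal N}\to\mathbb R$ that is non-negative and submodular, i.e. $f(A\cup\{s\})-f(A)\ge f(B\cup\{s\})-f(B)$ for all $A\subseteq B\subseteq\mathcal N$ and $s\in\mathcal N\setminus B$. For every such $n$, $k$ and $f$: \begin{enumerate} \item the algorithm always outputs a set $S\subseteq\mathcal N$ with $|S|\le k$; \item $\mathbb E[f(S)]\ \ge\ 0.385\cdot\max\{f(T) : T\subseteq\mathcal N,\ |T|\le k\}$, where the expectation is over the random choices of the algorithm; \item for every outcome of its random choices, the algorithm makes at most $C\,(n+k^2)$ queries to the value oracle of $f$. \end{enumerate} Here a randomized algorithm in the value-oracle model is an adaptive procedure that, for each $n$ and $k$, knows $f$ only through oracle queries: at each step it either queries $f(S)$ for a set $S\subseteq\mathcal N$ of its choice, or draws a uniformly random integer from a finite range $\{0,\dots,m\}$ of its choice, or halts and outputs a set; each step may depend on all previous answers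 and draws. The complexity measure is the number of oracle queries. -/

import Mathlib

/-- A real-valued set function `f` on the subsets of `N` is submodular if it has diminishing
returns: for all `A ⊆ B` and every element `s ∉ B`, `f (s ∣ A) ≥ f (s ∣ B)`, where
`f (s ∣ A) = f (A ∪ {s}) - f A` is the marginal gain of `s`. -/
def IsSubmodular {N : Type*} [DecidableEq N] (f : Finset N → ℝ) : Prop :=
  ∀ A B : Finset N, A ⊆ B → ∀ s : N, s ∉ B →
    f (insert s B) - f B ≤ f (insert s A) - f A

/-- The optimum `max {f S : S ⊆ N, |S| ≤ k}`. -/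
noncomputable def cardOpt {N : Type*} [Fintype N] (f : Finset N → ℝ) (k : ℕ) : ℝ :=
  (Finset.univ.filter fun S : Finset N => S.card ≤ k).sup' ⟨∅, by simp⟩ f

/-- A randomized adaptive algorithm in the value-oracle model on the ground set `N`, whose
objective function is accessible only through queries. At each step the algorithm

* halts and outputs a set, or
* queries the value of the objective function at a set of its choice, and continues in a way that
  may depend on the (real) answer, or
* draws a fresh uniformly random element of `{0, …, m}` for some `m` of its choice, and continues
  in a way that may depend on the drawn number.

Every choice may depend on all the earlier answers and random draws. -/
inductive QueryAlgorithm (N : Type*) where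
  | output (S : Finset N) : QueryAlgorithm N
  | query (S : Finset N) (next : ℝ → QueryAlgorithm N) : QueryAlgorithm N
  | draw (m : ℕ) (next : Fin (m + 1) → QueryAlgorithm N) : QueryAlgorithm N

namespace QueryAlgorithm

variable {N : Type*}

/-- The worst-case (over the random draws) number of oracle queries that the algorithm makes when
the oracle answers according to `f`. -/
def numQueries (f : Finset N → ℝ) : QueryAlgorithm N → ℕ
  | output _ => 0
  | query S next => numQueries f (next (f S)) + 1
  | draw _ next => Finset.univ.sup fun i => numQueries f (next i)

/-- The set `T` is a possible output (it is output for some outcome of the random draws) of the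
algorithm when the oracle answers according to `f`. -/
def CanOutput (f : Finset N → ℝ) (T : Finset N) : QueryAlgorithm N → Prop
  | output S => T = S
  | query S next => CanOutput f T (next (f S))
  | draw _ next => ∃ i, CanOutput f T (next i)

/-- The expectation, over the random draws of the algorithm, of the value `f S` of its output set
`S`, when the oracle answers according to `f`. -/
noncomputable def expectedValue (f : Finset N → ℝ) : QueryAlgorithm N → ℝ
  | output S => f S
  | query S next => expectedValue f (next (f S))
  | draw m next => (∑ i, expectedValue f (next i)) / ((m : ℝ) + 1)

end QueryAlgorithm

/-!
The algorithm combines two procedures and outputs the better one of their results. Let `O` be an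
optimal set.

* A randomized local search (`OracleProg.randomLocalSearch`) yields a set `Z` that, in expectation
  and up to a small error, satisfies `2 * f Z ≥ f (Z ∪ O) + f (Z ∩ O)` and `f Z ≥ f (Z ∩ O)`. One
  step gains `η / k` times the violation of either condition (`OracleProg.le_ev_localStep`), and the
  total gain is at most `f O`, so that after a uniformly random number of `O(k)` steps the average
  violation is small. No estimate of `f O` and no good initial solution is needed.
* A random greedy algorithm (`OracleProg.greedy`) avoids `Z` in about the first `0.372 * k` of its
  `k` steps. If `f Z` is small, then so is the sum of `f (Z ∩ O)` and `f (Z ∪ O)`. A small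
  `f (Z ∩ O)` means that `O \ Z` is almost optimal, so that little is lost by avoiding `Z`; and as
  long as `A` avoids `Z`, submodularity bounds the expected loss `f O - f (A ∪ O)` by a fraction of
  `f (Z ∪ O)`, where for a general `A` it would be a fraction of `f O`. The outcome
  (`OracleProg.le_ev_greedy`) has the form `η * (cO * f O - cI * f (Z ∩ O) - cU * f (Z ∪ O))`.

A linear combination of these inequalities gives the ratio `cO / (1 + cI + cU)`, which exceeds
`0.385` for every `k` (`exists_phase_length_coeffs`).

To keep the number of queries at `O(n + k ^ 2)`, a step of either procedure evaluates only
`c * n / k` random elements, for a large constant `c`, and uses a random one of the `c` best of them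
(`OracleProg.pick`). Then no element is used with probability above `1 / k`
(`OracleProg.ev_pick_le`), and the expected gain is at least `η / k` times the total gain of any `k`
elements, with `η` close to `1` (`OracleProg.le_ev_pick`).

All bounds are linear in the expectation, so they are proved step by step, conditionally on the
current set.
-/

/-! ### Randomized oracle programs -/

/-- A randomized program with value-oracle access that returns a result of type `α`. It is the
model `QueryAlgorithm` with an arbitrary type of results, so that programs can be composed. -/
inductive OracleProg (N : Type) (α : Type) where
  | pure (a : α) : OracleProg N α
  | query (S : Finset N) (next : ℝ → OracleProg N α) : OracleProg N α
  | draw (m : ℕ) (next : Fin (m + 1) → OracleProg N α) : OracleProg N α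

namespace OracleProg

variable {N α β : Type}

/-- Sequential composition. -/
def bind : OracleProg N α → (α → OracleProg N β) → OracleProg N β
  | pure a, q => q a
  | query S next, q => query S fun r => (next r).bind q
  | draw m next, q => draw m fun i => (next i).bind q

/-- The expectation of `φ` of the result when the oracle answers according to `f`. -/
noncomputable def ev (f : Finset N → ℝ) : OracleProg N α → (α → ℝ) → ℝ
  | pure a, φ => φ a
  | query S next, φ => ev f (next (f S)) φ
  | draw m next, φ => (∑ i, ev f (next i) φ) / ((m : ℝ) + 1)

/-- Every possible result satisfies `P` when the oracle answers according to `f`. -/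
def Always (f : Finset N → ℝ) (P : α → Prop) : OracleProg N α → Prop
  | pure a => P a
  | query S next => Always f P (next (f S))
  | draw _ next => ∀ i, Always f P (next i)

/-- The worst-case number of queries when the oracle answers according to `f`. -/
def cost (f : Finset N → ℝ) : OracleProg N α → ℕ
  | pure _ => 0
  | query S next => cost f (next (f S)) + 1
  | draw _ next => Finset.univ.sup fun i => cost f (next i)

/-- A program whose result is a set, read as a `QueryAlgorithm`. -/
def toAlg : OracleProg N (Finset N) → QueryAlgorithm N
  | pure S => .output S
  | query S next => .query S fun r => (next r).toAlg
  | draw m next => .draw m fun i => (next i).toAlg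

variable {f : Finset N → ℝ}

theorem ev_bind (p : OracleProg N α) (q : α → OracleProg N β) (φ : β → ℝ) :
    ev f (p.bind q) φ = ev f p fun a => ev f (q a) φ := by
  induction p with
  | pure a => rfl
  | query S next ih => exact ih _
  | draw m next ih => simp only [bind, ev, ih]

theorem always_bind (p : OracleProg N α) (q : α → OracleProg N β) (P : β → Prop) :
    Always f P (p.bind q) ↔ Always f (fun a => Always f P (q a)) p := by
  induction p with
  | pure a => rfl
  | query S next ih => exact ih _
  | draw m next ih => simp only [bind, Always, ih]

theorem Always.mono {P Q : α → Prop} {p : OracleProg N α} (h : Always f P p)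
    (hPQ : ∀ a, P a → Q a) : Always f Q p := by
  induction p with
  | pure a => exact hPQ a h
  | query S next ih => exact ih _ h
  | draw m next ih => exact fun i => ih i (h i)

theorem always_of_forall {P : α → Prop} (h : ∀ a, P a) (p : OracleProg N α) : Always f P p := by
  induction p with
  | pure a => exact h a
  | query S next ih => exact ih _
  | draw m next ih => exact fun i => ih i

theorem ev_mono {p : OracleProg N α} {φ ψ : α → ℝ} (h : Always f (fun a => φ a ≤ ψ a) p) :
    ev f p φ ≤ ev f p ψ := by
  induction p with
  | pure a => exact h
  | query S next ih => exact ih _ h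
  | draw m next ih =>
    exact div_le_div_of_nonneg_right (Finset.sum_le_sum fun i _ => ih i (h i)) (by positivity)

theorem ev_const (p : OracleProg N α) (c : ℝ) : ev f p (fun _ => c) = c := by
  induction p with
  | pure a => rfl
  | query S next ih => exact ih _
  | draw m next ih =>
    have : (m : ℝ) + 1 ≠ 0 := by positivity
    simp only [ev, ih, Finset.sum_const, Finset.card_univ, Fintype.card_fin, nsmul_eq_mul]
    push_cast
    field_simp

theorem ev_add (p : OracleProg N α) (φ ψ : α → ℝ) :
    ev f p (fun a => φ a + ψ a) = ev f p φ + ev f p ψ := by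
  induction p with
  | pure a => rfl
  | query S next ih => exact ih _
  | draw m next ih => simp only [ev, ih, Finset.sum_add_distrib, add_div]

theorem ev_const_mul (p : OracleProg N α) (c : ℝ) (φ : α → ℝ) :
    ev f p (fun a => c * φ a) = c * ev f p φ := by
  induction p with
  | pure a => rfl
  | query S next ih => exact ih _
  | draw m next ih => simp only [ev, ih, ← Finset.mul_sum, mul_div_assoc]

theorem ev_sub (p : OracleProg N α) (φ ψ : α → ℝ) :
    ev f p (fun a => φ a - ψ a) = ev f p φ - ev f p ψ := by
  have h := ev_add (f := f) p φ fun a => (-1) * ψ a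
  rw [ev_const_mul] at h
  rw [sub_eq_add_neg, ← neg_one_mul, ← h]
  congr 1
  funext a
  ring

theorem ev_const_add (p : OracleProg N α) (c : ℝ) (φ : α → ℝ) :
    ev f p (fun a => c + φ a) = c + ev f p φ := by
  rw [ev_add, ev_const]

theorem ev_const_sub (p : OracleProg N α) (c : ℝ) (φ : α → ℝ) :
    ev f p (fun a => c - φ a) = c - ev f p φ := by
  rw [ev_sub, ev_const]

theorem ev_nonneg {p : OracleProg N α} {φ : α → ℝ} (h : ∀ a, 0 ≤ φ a) : 0 ≤ ev f p φ := by
  rw [← ev_const (f := f) p 0]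
  exact ev_mono (always_of_forall h p)

theorem cost_bind_le {p : OracleProg N α} {q : α → OracleProg N β} {b c : ℕ}
    (hp : cost f p ≤ b) (hq : Always f (fun a => cost f (q a) ≤ c) p) :
    cost f (p.bind q) ≤ b + c := by
  induction p generalizing b with
  | pure a => exact le_trans hq (Nat.le_add_left _ _)
  | query S next ih =>
    obtain ⟨b, rfl⟩ : ∃ b', b = b' + 1 := ⟨b - 1, by simp only [cost] at hp; omega⟩
    have := ih (f S) (b := b) (by simpa [cost] using hp) hq
    simp only [bind, cost]
    omega
  | draw m next ih =>
    simp only [bind, cost, Finset.sup_le_iff, Finset.mem_univ, true_implies] at hp ⊢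
    exact fun i => ih i (hp i) (hq i)

theorem expectedValue_toAlg (p : OracleProg N (Finset N)) :
    p.toAlg.expectedValue f = ev f p f := by
  induction p with
  | pure a => rfl
  | query S next ih => exact ih _
  | draw m next ih => simp only [toAlg, ev, QueryAlgorithm.expectedValue, ih]

theorem numQueries_toAlg (p : OracleProg N (Finset N)) :
    p.toAlg.numQueries f = cost f p := by
  induction p with
  | pure a => rfl
  | query S next ih => simp only [toAlg, cost, QueryAlgorithm.numQueries, ih]
  | draw m next ih => simp only [toAlg, cost, QueryAlgorithm.numQueries, ih]

theorem Always.of_canOutput_toAlg {P : Finset N → Prop} {p : OracleProg N (Finset N)}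
    (h : Always f P p) {T : Finset N} (hT : p.toAlg.CanOutput f T) : P T := by
  induction p with
  | pure a => rw [show T = a from hT]; exact h
  | query S next ih => exact ih _ h hT
  | draw m next ih =>
    obtain ⟨i, hi⟩ := hT
    exact ih i (h i) hi

end OracleProg

/-! ### Sampling an element of large weight -/

/-- Some sublist of `l` of length at most `c` whose total weight is largest. -/
theorem exists_heaviest {α : Type} (c : ℕ) (l : List (α × ℝ)) :
    ∃ h : List (α × ℝ), h.Sublist l ∧ h.length ≤ c ∧ ∀ l' : List (α × ℝ), l'.Sublist l →
      l'.length ≤ c → (l'.map Prod.snd).sum ≤ (h.map Prod.snd).sum := by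
  classical
  obtain ⟨h, hmem, hmax⟩ := (l.sublists.toFinset.filter fun h => h.length ≤ c).exists_max_image
    (fun h => (h.map Prod.snd).sum) ⟨[], by simp⟩
  simp only [Finset.mem_filter, List.mem_toFinset, List.mem_sublists] at hmem hmax
  exact ⟨h, hmem.1, hmem.2, fun l' h1 h2 => hmax l' ⟨h1, h2⟩⟩

/-- A sublist of `l` of length at most `c` of largest total weight, for a list `l` of elements
paired with their weights. -/
noncomputable def heaviest {α : Type} (c : ℕ) (l : List (α × ℝ)) : List (α × ℝ) :=
  (exists_heaviest c l).choose

theorem heaviest_sublist {α : Type} (c : ℕ) (l : List (α × ℝ)) : (heaviest c l).Sublist l :=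
  (exists_heaviest c l).choose_spec.1

theorem heaviest_length_le {α : Type} (c : ℕ) (l : List (α × ℝ)) : (heaviest c l).length ≤ c :=
  (exists_heaviest c l).choose_spec.2.1

theorem sum_le_sum_heaviest {α : Type} {c : ℕ} {l l' : List (α × ℝ)} (h : l'.Sublist l)
    (hc : l'.length ≤ c) : (l'.map Prod.snd).sum ≤ ((heaviest c l).map Prod.snd).sum :=
  (exists_heaviest c l).choose_spec.2.2 l' h hc

theorem List.sum_getElem?_elim {α : Type} (w : α → ℝ) (l : List α) (c : ℕ) (h : l.length ≤ c) :
    ∑ j : Fin c, (l[j.1]?).elim 0 w = (l.map w).sum := by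
  induction l generalizing c with
  | nil => simp
  | cons a l ih =>
    obtain ⟨c, rfl⟩ : ∃ c', c = c' + 1 := ⟨c - 1, by simp at h; omega⟩
    rw [Fin.sum_univ_succ]
    simpa using ih c (by simpa using h)

namespace OracleProg

variable {m : ℕ} {f : Finset (Fin (m + 1)) → ℝ}

/-- Draws `s` independent uniform elements `u` of the ground set, and returns their list, each
element `u` paired with the weight `W u (f (Q u))`. -/
def sample (Q : Fin (m + 1) → Finset (Fin (m + 1))) (W : Fin (m + 1) → ℝ → ℝ) :
    ℕ → OracleProg (Fin (m + 1)) (List (Fin (m + 1) × ℝ))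
  | 0 => pure []
  | s + 1 => draw m fun u => query (Q u) fun r =>
      (sample Q W s).bind fun l => pure ((u, W u r) :: l)

variable {Q : Fin (m + 1) → Finset (Fin (m + 1))} {W : Fin (m + 1) → ℝ → ℝ}

theorem ev_sample_succ (s : ℕ) (φ : List (Fin (m + 1) × ℝ) → ℝ) :
    ev f (sample Q W (s + 1)) φ =
      (∑ u, ev f (sample Q W s) fun l => φ ((u, W u (f (Q u))) :: l)) / ((m : ℝ) + 1) := by
  simp only [sample, ev, ev_bind]

theorem always_sample (s : ℕ) :
    Always f (fun l => ∀ p ∈ l, p.2 = W p.1 (f (Q p.1))) (sample Q W s) := by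
  induction s with
  | zero => simp [sample, Always]
  | succ s ih =>
    intro u
    rw [Always, always_bind]
    exact ih.mono fun l hl => by simpa [Always] using hl

theorem cost_sample (s : ℕ) : cost f (sample Q W s) ≤ s := by
  induction s with
  | zero => simp [sample, cost]
  | succ s ih =>
    simp only [sample, cost, Finset.sup_le_iff]
    intro u _
    exact Nat.succ_le_succ (cost_bind_le (c := 0) ih (always_of_forall (fun _ => le_rfl) _))

/-- Each element occurs in the sample `s / (m + 1)` times in expectation. -/
theorem ev_sample_sum (ψ : Fin (m + 1) → ℝ) (s : ℕ) :
    ev f (sample Q W s) (fun l => (l.map fun p => ψ p.1).sum) =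
      s * (∑ u, ψ u) / ((m : ℝ) + 1) := by
  induction s with
  | zero => simp [sample, ev]
  | succ s ih =>
    have hm : (m : ℝ) + 1 ≠ 0 := by positivity
    rw [ev_sample_succ]
    simp only [List.map_cons, List.sum_cons, ev_add, ev_const, ih, Finset.sum_add_distrib,
      Finset.sum_const, Finset.card_univ, Fintype.card_fin, nsmul_eq_mul]
    push_cast
    field_simp
    ring

/-- The total weight of the first `c` elements of the sample that lie in `T`. -/
def firstSum (T : Finset (Fin (m + 1))) (c : ℕ) (l : List (Fin (m + 1) × ℝ)) : ℝ :=
  (((l.filter fun p => p.1 ∈ T).take c).map Prod.snd).sum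

/-- The number `X` of sampled elements of `T` is binomial with mean `s * q`, where
`q = |T| / (m + 1)`, and `min c X ≥ X - δ - (X - c) ^ 2 / (4 * δ)`. The expectation of the right
hand side is explicit and satisfies the same recursion in `s` as that of `min c X`. -/
theorem le_ev_firstSum (T : Finset (Fin (m + 1))) {δ : ℝ} (hδ : 0 < δ)
    (hw : ∀ u, 0 ≤ W u (f (Q u))) (s c : ℕ) :
    (∑ u ∈ T, W u (f (Q u))) * (s * (T.card / ((m : ℝ) + 1)) - δ -
      ((s * (T.card / ((m : ℝ) + 1)) - c) ^ 2 +
        s * (T.card / ((m : ℝ) + 1)) * (1 - T.card / ((m : ℝ) + 1))) / (4 * δ)) ≤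
      T.card * ev f (sample Q W s) (firstSum T c) := by
  have hW : 0 ≤ ∑ u ∈ T, W u (f (Q u)) := Finset.sum_nonneg fun u _ => hw u
  have hm : 0 < (m : ℝ) + 1 := by positivity
  have hcard : (T.card : ℝ) ≤ m + 1 := by
    have h := Finset.card_le_univ T
    rw [Fintype.card_fin] at h
    exact_mod_cast h
  set q : ℝ := T.card / ((m : ℝ) + 1) with hq
  have hq0 : 0 ≤ q := by positivity
  have hq1 : q ≤ 1 := by rw [hq, div_le_one hm]; exact hcard
  have hqT : (T.card : ℝ) = q * (m + 1) := by rw [hq]; field_simp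
  set w := ∑ u ∈ T, W u (f (Q u)) with hwdef
  induction s generalizing c with
  | zero =>
    have : ev f (sample Q W 0) (firstSum T c) = 0 := by simp [sample, ev, firstSum]
    rw [this, mul_zero]
    refine mul_nonpos_of_nonneg_of_nonpos hW ?_
    have : 0 ≤ (((0 : ℕ) * q - c) ^ 2 + (0 : ℕ) * q * (1 - q)) / (4 * δ) := by
      refine div_nonneg ?_ (by positivity)
      simp
    push_cast at this ⊢
    linarith
  | succ s ih =>
    cases c with
    | zero =>
      have : ev f (sample Q W (s + 1)) (firstSum T 0) = 0 := by
        rw [show firstSum T 0 = fun _ => (0 : ℝ) by funext l; simp [firstSum], ev_const]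
      rw [this, mul_zero]
      refine mul_nonpos_of_nonneg_of_nonpos hW ?_
      rw [sub_nonpos, le_div_iff₀ (by positivity)]
      have h1 : 0 ≤ ((s + 1 : ℕ) : ℝ) * q * (1 - q) :=
        mul_nonneg (mul_nonneg (Nat.cast_nonneg _) hq0) (by linarith)
      push_cast at h1 ⊢
      nlinarith [sq_nonneg (((s : ℝ) + 1) * q - 2 * δ)]
    | succ c =>
      have hrec : ev f (sample Q W (s + 1)) (firstSum T (c + 1)) =
          w / (m + 1) + q * ev f (sample Q W s) (firstSum T c) +
            (1 - q) * ev f (sample Q W s) (firstSum T (c + 1)) := by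
        rw [ev_sample_succ]
        have h1 : ∀ u, (ev f (sample Q W s) fun l =>
            firstSum T (c + 1) ((u, W u (f (Q u))) :: l)) =
              ev f (sample Q W s) (firstSum T (c + 1)) + if u ∈ T then W u (f (Q u)) +
                (ev f (sample Q W s) (firstSum T c) -
                  ev f (sample Q W s) (firstSum T (c + 1))) else 0 := by
          intro u
          split_ifs with hu
          · have : (fun l => firstSum T (c + 1) ((u, W u (f (Q u))) :: l)) =
                fun l => W u (f (Q u)) + firstSum T c l := by
              funext l; simp [firstSum, hu]
            rw [this, ev_add, ev_const]
            ring
          · have : (fun l => firstSum T (c + 1) ((u, W u (f (Q u))) :: l)) =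
                firstSum T (c + 1) := by
              funext l; simp [firstSum, hu]
            rw [this, add_zero]
        simp only [h1, Finset.sum_add_distrib, Finset.sum_ite_mem, Finset.univ_inter,
          Finset.sum_const, Finset.card_univ, Fintype.card_fin, nsmul_eq_mul]
        rw [← hwdef, hqT]
        push_cast
        field_simp
        ring
      rw [hrec]
      have e1 := mul_le_mul_of_nonneg_left (ih c) hq0
      have e2 := mul_le_mul_of_nonneg_left (ih (c + 1)) (sub_nonneg.2 hq1)
      have e3 : (T.card : ℝ) * (w / (m + 1)) = q * w := by rw [hqT]; field_simp
      have e4 : w * (((s + 1 : ℕ) : ℝ) * q - δ -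
          ((((s + 1 : ℕ) : ℝ) * q - ((c + 1 : ℕ) : ℝ)) ^ 2 +
            ((s + 1 : ℕ) : ℝ) * q * (1 - q)) / (4 * δ)) =
          q * w + q * (w * (s * q - δ - ((s * q - c) ^ 2 + s * q * (1 - q)) / (4 * δ))) +
          (1 - q) * (w * (s * q - δ - ((s * q - ((c + 1 : ℕ) : ℝ)) ^ 2 +
            s * q * (1 - q)) / (4 * δ))) := by
        push_cast
        field_simp
        ring
      rw [e4]
      nlinarith [e1, e2, e3]

/-- Samples `s` elements with weights and returns a uniformly random one of the `d + 1` heaviest of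
them, unless this one does not exist or its weight is not positive. -/
noncomputable def pick (Q : Fin (m + 1) → Finset (Fin (m + 1))) (W : Fin (m + 1) → ℝ → ℝ)
    (s d : ℕ) : OracleProg (Fin (m + 1)) (Option (Fin (m + 1) × ℝ)) :=
  (sample Q W s).bind fun l => draw d fun j =>
    pure (((heaviest (d + 1) l)[j.1]?).filter fun p => 0 < p.2)

theorem always_pick (s d : ℕ) :
    Always f (fun o => ∀ p ∈ o, 0 < p.2 ∧ p.2 = W p.1 (f (Q p.1))) (pick Q W s d) := by
  rw [pick, always_bind]
  refine (always_sample s).mono fun l hl j p hp => ?_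
  rw [Option.mem_def, Option.filter_eq_some_iff] at hp
  exact ⟨by simpa using hp.2,
    hl p ((heaviest_sublist (d + 1) l).subset (List.mem_of_getElem? hp.1))⟩

theorem cost_pick (s d : ℕ) : cost f (pick Q W s d) ≤ s :=
  cost_bind_le (c := 0) (cost_sample s) (always_of_forall (fun l => by simp [cost]) _)

/-- No element is picked with probability more than `1 / k`, in a functional form. -/
theorem ev_pick_le {s d k : ℕ} (hk : 0 < k) (hs : s * k ≤ (d + 1) * (m + 1))
    (ψ : Fin (m + 1) → ℝ) (hψ : ∀ u, 0 ≤ ψ u) :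
    ev f (pick Q W s d) (fun o => o.elim 0 fun p => ψ p.1) ≤ (∑ u, ψ u) / k := by
  have hd : 0 < (d : ℝ) + 1 := by positivity
  rw [pick, ev_bind]
  have h1 : ∀ l : List (Fin (m + 1) × ℝ), ev f (draw d fun j =>
      pure (((heaviest (d + 1) l)[j.1]?).filter fun p => 0 < p.2))
        (fun o => o.elim 0 fun p => ψ p.1) ≤
      (1 / ((d : ℝ) + 1)) * (l.map fun p => ψ p.1).sum := by
    intro l
    simp only [ev]
    rw [one_div, inv_mul_eq_div]
    refine div_le_div_of_nonneg_right ?_ hd.le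
    have h2 : ∑ j : Fin (d + 1), ((heaviest (d + 1) l)[j.1]?).elim 0 (fun p => ψ p.1) ≤
        (l.map fun p => ψ p.1).sum := by
      rw [List.sum_getElem?_elim _ _ _ (heaviest_length_le _ _)]
      exact ((heaviest_sublist (d + 1) l).map _).sum_le_sum fun x hx => by
        obtain ⟨p, -, rfl⟩ := List.mem_map.1 hx
        exact hψ _
    refine le_trans (Finset.sum_le_sum fun j _ => ?_) h2
    cases (heaviest (d + 1) l)[j.1]? with
    | none => simp
    | some p =>
      rw [Option.filter_some]
      split_ifs
      · exact le_rfl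
      · exact hψ _
  refine (ev_mono (always_of_forall h1 _)).trans ?_
  rw [ev_const_mul, ev_sample_sum]
  have hS : 0 ≤ ∑ u, ψ u := Finset.sum_nonneg fun u _ => hψ u
  have hk' : (0 : ℝ) < k := by exact_mod_cast hk
  have hs' : (s : ℝ) * k ≤ (d + 1) * (m + 1) := by exact_mod_cast hs
  have hm : 0 < (m : ℝ) + 1 := by positivity
  rw [← mul_div_assoc, div_le_div_iff₀ hm hk', one_div, inv_mul_eq_div, div_mul_eq_mul_div,
    div_le_iff₀ hd]
  nlinarith [mul_le_mul_of_nonneg_left hs' hS]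

/-- The picked element has, in expectation, almost `1 / k` of the total weight of any `k`
elements. The loss `η` comes from the fluctuation of the number of sampled elements among these `k`
ones. -/
theorem le_ev_pick {s d k : ℕ} {η δ : ℝ} (hk : 0 < k) (hkm : k ≤ m + 1) (hδ : 0 < δ)
    (hs : s * k ≤ (d + 1) * (m + 1)) (hs' : (d + 1) * (m + 1) ≤ s * k + k)
    (hη : η * (d + 1) ≤ d - δ - (d + 2) / (4 * δ))
    (hw : ∀ u, 0 ≤ W u (f (Q u))) {T : Finset (Fin (m + 1))} (hT : T.card ≤ k) (hη0 : 0 ≤ η) :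
    η / k * ∑ u ∈ T, W u (f (Q u)) ≤
      ev f (pick Q W s d) (fun o => o.elim 0 fun p => p.2) := by
  have hd : 0 < (d : ℝ) + 1 := by positivity
  have hm : 0 < (m : ℝ) + 1 := by positivity
  have hk' : (0 : ℝ) < k := by exact_mod_cast hk
  obtain ⟨T', hTT', -, hT'⟩ := Finset.exists_subsuperset_card_eq (Finset.subset_univ T) hT
    (by simpa using hkm)
  have hWT' : 0 ≤ ∑ u ∈ T', W u (f (Q u)) := Finset.sum_nonneg fun u _ => hw u
  have hTT : ∑ u ∈ T, W u (f (Q u)) ≤ ∑ u ∈ T', W u (f (Q u)) :=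
    Finset.sum_le_sum_of_subset_of_nonneg hTT' fun u _ _ => hw u
  have h1 := le_ev_firstSum (f := f) (Q := Q) (W := W) T' hδ hw s (d + 1)
  rw [hT'] at h1
  -- the mean number of hits of `T'` is between `d` and `d + 1`
  set x : ℝ := s * (k / ((m : ℝ) + 1)) with hx
  have hs1 : (s : ℝ) * k ≤ (d + 1) * (m + 1) := by exact_mod_cast hs
  have hs2 : ((d : ℝ) + 1) * (m + 1) ≤ s * k + k := by exact_mod_cast hs'
  have hkm' : (k : ℝ) ≤ m + 1 := by exact_mod_cast hkm
  have hx1 : x ≤ d + 1 := by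
    rw [hx, ← mul_div_assoc, div_le_iff₀ hm]; exact hs1
  have hx2 : d ≤ x := by
    rw [hx, ← mul_div_assoc, le_div_iff₀ hm]; nlinarith
  have hq0 : 0 ≤ (k : ℝ) / (m + 1) := by positivity
  have hq1 : (k : ℝ) / (m + 1) ≤ 1 := by rw [div_le_one hm]; exact hkm'
  have hφ : η * (d + 1) ≤ x - δ - ((x - ((d + 1 : ℕ) : ℝ)) ^ 2 +
      x * (1 - k / ((m : ℝ) + 1))) / (4 * δ) := by
    have : (x - ((d + 1 : ℕ) : ℝ)) ^ 2 + x * (1 - k / ((m : ℝ) + 1)) ≤ d + 2 := by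
      have hd0 : (0 : ℝ) ≤ d := by positivity
      push_cast
      have : x * (1 - k / ((m : ℝ) + 1)) ≤ x * 1 :=
        mul_le_mul_of_nonneg_left (by linarith) (by linarith)
      nlinarith
    have := div_le_div_of_nonneg_right this (by positivity : 0 ≤ 4 * δ)
    linarith
  have h2 : (∑ u ∈ T', W u (f (Q u))) * (η * (d + 1)) ≤
      k * ev f (sample Q W s) (firstSum T' (d + 1)) :=
    (mul_le_mul_of_nonneg_left hφ hWT').trans h1
  have h3 : (1 / ((d : ℝ) + 1)) * ev f (sample Q W s) (firstSum T' (d + 1)) ≤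
      ev f (pick Q W s d) (fun o => o.elim 0 fun p => p.2) := by
    rw [pick, ev_bind, ← ev_const_mul]
    refine ev_mono ((always_sample s).mono fun l hl => ?_)
    simp only [ev]
    rw [one_div, inv_mul_eq_div]
    refine div_le_div_of_nonneg_right ?_ hd.le
    have h4 : firstSum T' (d + 1) l ≤
        ∑ j : Fin (d + 1), ((heaviest (d + 1) l)[j.1]?).elim 0 (fun p => p.2) := by
      rw [List.sum_getElem?_elim _ _ _ (heaviest_length_le _ _)]
      exact sum_le_sum_heaviest ((List.take_sublist _ _).trans List.filter_sublist)
        (List.length_take_le _ _)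
    refine h4.trans (Finset.sum_le_sum fun j _ => ?_)
    cases (heaviest (d + 1) l)[j.1]? with
    | none => simp
    | some p =>
      rw [Option.filter_some]
      split_ifs with hp
      · exact le_rfl
      · simpa using hp
  refine le_trans ?_ h3
  have h5 : η / k * ∑ u ∈ T, W u (f (Q u)) ≤ η / k * ∑ u ∈ T', W u (f (Q u)) :=
    mul_le_mul_of_nonneg_left hTT (by positivity)
  refine h5.trans ?_
  rw [one_div, inv_mul_eq_div, le_div_iff₀ hd, div_mul_eq_mul_div, div_mul_eq_mul_div,
    div_le_iff₀ hk']
  linarith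

end OracleProg

/-! ### Submodular functions -/

namespace IsSubmodular

variable {N : Type*} [DecidableEq N] {f : Finset N → ℝ}

theorem union_sub_le (hf : IsSubmodular f) {A B : Finset N} (hAB : A ⊆ B) (D : Finset N)
    (hD : Disjoint D B) : f (B ∪ D) - f B ≤ f (A ∪ D) - f A := by
  induction D using Finset.induction_on with
  | empty => simp
  | insert s D hs ih =>
    rw [Finset.disjoint_insert_left] at hD
    have h := hf (A ∪ D) (B ∪ D) (Finset.union_subset_union_left hAB) s (by simp [hs, hD.1])
    rw [Finset.union_insert, Finset.union_insert]
    linarith [ih hD.2]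

theorem union_add_inter_le (hf : IsSubmodular f) (A B : Finset N) :
    f (A ∪ B) + f (A ∩ B) ≤ f A + f B := by
  have h := hf.union_sub_le (A := A ∩ B) (B := A) Finset.inter_subset_left (B \ A)
    Finset.sdiff_disjoint
  have h2 : A ∩ B ∪ B \ A = B := by ext x; by_cases x ∈ A <;> simp_all
  rw [Finset.union_sdiff_self_eq_union, h2] at h
  linarith

/-- The marginal gain of a set is at most the sum of the marginal gains of its elements. -/
theorem union_sub_le_sum (hf : IsSubmodular f) (S T : Finset N) :
    f (S ∪ T) - f S ≤ ∑ u ∈ T \ S, (f (insert u S) - f S) := by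
  have key : ∀ D : Finset N, Disjoint D S →
      f (S ∪ D) - f S ≤ ∑ u ∈ D, (f (insert u S) - f S) := by
    intro D hD
    induction D using Finset.induction_on with
    | empty => simp
    | insert s D hs ih =>
      rw [Finset.disjoint_insert_left] at hD
      have h := hf S (S ∪ D) Finset.subset_union_left s (by simp [hs, hD.1])
      rw [Finset.sum_insert hs, Finset.union_insert]
      linarith [ih hD.2]
  simpa using key (T \ S) Finset.sdiff_disjoint

/-- Removing a set loses at least the sum of the losses of removing its elements one by one. -/
theorem sum_sub_erase_le (hf : IsSubmodular f) (S R : Finset N) (hR : R ⊆ S) :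
    ∑ v ∈ R, (f S - f (S.erase v)) ≤ f S - f (S \ R) := by
  induction R using Finset.induction_on with
  | empty => simp
  | insert s R hs ih =>
    rw [Finset.insert_subset_iff] at hR
    have hsub : (S \ R).erase s ⊆ S.erase s := Finset.erase_subset_erase _ Finset.sdiff_subset
    have h := hf _ _ hsub s (Finset.notMem_erase s S)
    rw [Finset.insert_erase hR.1, Finset.insert_erase (by simp [hR.1, hs])] at h
    rw [Finset.sum_insert hs, Finset.sdiff_insert]
    linarith [ih hR.2]

/-- For a nonnegative submodular function, the single-element losses sum up to at most the
current value. -/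
theorem sum_loss_le (hf : IsSubmodular f) (h0 : ∀ S, 0 ≤ f S) [Fintype N] (X : Finset N) :
    ∑ u, max 0 (f X - f (insert u X)) ≤ f X := by
  have h := hf.union_sub_le_sum X (Finset.univ.filter fun u => f (insert u X) < f X)
  have h1 : ∑ u, max 0 (f X - f (insert u X)) =
      ∑ u ∈ (Finset.univ.filter fun u => f (insert u X) < f X) \ X,
        (f X - f (insert u X)) := by
    have : (Finset.univ.filter fun u => f (insert u X) < f X) \ X =
        Finset.univ.filter fun u => f (insert u X) < f X := by
      rw [Finset.sdiff_eq_self_iff_disjoint, Finset.disjoint_left]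
      intro u hu huX
      simp [Finset.insert_eq_of_mem huX] at hu
    rw [this, Finset.sum_filter]
    refine Finset.sum_congr rfl fun u _ => ?_
    split_ifs with hu
    · exact max_eq_right (by linarith)
    · exact max_eq_left (by linarith)
  rw [h1]
  have h2 := Finset.sum_neg_distrib (s := (Finset.univ.filter fun u => f (insert u X) < f X) \ X)
    (fun u => f (insert u X) - f X)
  simp only [neg_sub] at h2
  rw [h2]
  linarith [h0 (X ∪ Finset.univ.filter fun u => f (insert u X) < f X)]

end IsSubmodular

/-! ### Extending a set by a sampled element -/

/-- The parameters of the sampling: with `s` samples from a ground set of `m + 1` elements, of which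
one of the `d + 1` heaviest is chosen, at least a fraction `η` of the ideal gain is guaranteed. -/
structure SampleBounds (m k s d : ℕ) (η : ℝ) : Prop where
  pos : 0 < k
  le_ground : k ≤ m + 1
  mul_le : s * k ≤ (d + 1) * (m + 1)
  le_mul : (d + 1) * (m + 1) ≤ s * k + k
  loss : ∃ δ : ℝ, 0 < δ ∧ η * (d + 1) ≤ d - δ - (d + 2) / (4 * δ)
  eta_pos : 0 < η
  eta_le : η ≤ 1

namespace OracleProg

variable {m k s d : ℕ} {η : ℝ} {f : Finset (Fin (m + 1)) → ℝ}

/-- Inserts into `B` a sampled element outside of `E` for which the value exceeds `b`; if no such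
element is found, the result is `F`. -/
noncomputable def extend (E B : Finset (Fin (m + 1))) (b : ℝ) (F : Finset (Fin (m + 1)))
    (s d : ℕ) : OracleProg (Fin (m + 1)) (Finset (Fin (m + 1))) :=
  (pick (fun u => insert u B) (fun u r => if u ∈ E then 0 else max 0 (r - b)) s d).bind fun o =>
    pure (o.elim F fun p => insert p.1 B)

theorem always_extend (E B : Finset (Fin (m + 1))) (b : ℝ) (F : Finset (Fin (m + 1))) :
    Always f (fun A => A = F ∨ ∃ u ∉ E, A = insert u B) (extend E B b F s d) := by
  rw [extend, always_bind]
  refine (always_pick s d).mono fun o ho => ?_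
  cases o with
  | none => exact Or.inl rfl
  | some p =>
    obtain ⟨h1, h2⟩ := ho p rfl
    refine Or.inr ⟨p.1, fun hE => ?_, rfl⟩
    rw [h2, if_pos hE] at h1
    exact lt_irrefl _ h1

theorem cost_extend_le (E B : Finset (Fin (m + 1))) (b : ℝ) (F : Finset (Fin (m + 1))) :
    cost f (extend E B b F s d) ≤ s :=
  cost_bind_le (c := 0) (cost_pick s d) (always_of_forall (fun _ => le_rfl) _)

theorem le_ev_extend (h : SampleBounds m k s d η) {E B F : Finset (Fin (m + 1))} {b : ℝ}
    (hF : f F = b) {T : Finset (Fin (m + 1))} (hT : T.card ≤ k) (hTE : Disjoint T E) :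
    b + η / k * ∑ u ∈ T, max 0 (f (insert u B) - b) ≤ ev f (extend E B b F s d) f := by
  obtain ⟨δ, hδ, hη⟩ := h.loss
  have h1 := le_ev_pick (f := f) (Q := fun u => insert u B)
    (W := fun u r => if u ∈ E then 0 else max 0 (r - b)) h.pos h.le_ground hδ h.mul_le h.le_mul hη
    (fun u => by split_ifs <;> simp) hT h.eta_pos.le
  have h2 : ∑ u ∈ T, (if u ∈ E then 0 else max 0 (f (insert u B) - b)) =
      ∑ u ∈ T, max 0 (f (insert u B) - b) :=
    Finset.sum_congr rfl fun u hu => if_neg (Finset.disjoint_left.1 hTE hu)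
  rw [h2] at h1
  refine (add_le_add_right h1 b).trans ?_
  rw [extend, ev_bind, ← ev_const_add]
  refine ev_mono ((always_pick s d).mono fun o ho => ?_)
  cases o with
  | none => simp [ev, hF]
  | some p =>
    obtain ⟨h3, h4⟩ := ho p rfl
    by_cases hE : p.1 ∈ E
    · rw [h4, if_pos hE] at h3
      exact absurd h3 (lt_irrefl _)
    · rw [if_neg hE] at h4
      rw [h4] at h3
      simp only [Option.elim, ev]
      rw [h4, max_eq_right]
      · linarith
      · exact (lt_max_iff.1 h3).resolve_left (lt_irrefl _) |>.le

/-- As no element is inserted with probability more than `1 / k`, the expected value of the union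
with any set drops by a factor of at most `1 - 1 / k`. -/
theorem le_ev_extend_union (h : SampleBounds m k s d η) (hf : IsSubmodular f) (h0 : ∀ S, 0 ≤ f S)
    (E B X : Finset (Fin (m + 1))) (b : ℝ) :
    (1 - 1 / (k : ℝ)) * f (B ∪ X) ≤ ev f (extend E B b B s d) fun A => f (A ∪ X) := by
  have hk : (0 : ℝ) < k := by exact_mod_cast h.pos
  have h1 := ev_pick_le (f := f) (Q := fun u => insert u B)
    (W := fun u r => if u ∈ E then 0 else max 0 (r - b)) h.pos h.mul_le
    (fun u => max 0 (f (B ∪ X) - f (insert u (B ∪ X)))) fun u => le_max_left _ _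
  have h2 := div_le_div_of_nonneg_right (hf.sum_loss_le h0 (B ∪ X)) hk.le
  rw [extend, ev_bind]
  have h3 : f (B ∪ X) - ev f
      (pick (fun u => insert u B) (fun u r => if u ∈ E then 0 else max 0 (r - b)) s d)
      (fun o => o.elim 0 fun p => max 0 (f (B ∪ X) - f (insert p.1 (B ∪ X)))) ≤
      ev f (pick (fun u => insert u B) (fun u r => if u ∈ E then 0 else max 0 (r - b)) s d)
      fun o => ev f (pure (o.elim B fun p => insert p.1 B)) fun A => f (A ∪ X) := by
    rw [← ev_const_sub]
    refine ev_mono (always_of_forall (fun o => ?_) _)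
    cases o with
    | none => simp [ev]
    | some p =>
      simp only [Option.elim, ev, Finset.insert_union]
      linarith [le_max_right 0 (f (B ∪ X) - f (insert p.1 (B ∪ X)))]
  refine le_trans ?_ h3
  have : (1 - 1 / (k : ℝ)) * f (B ∪ X) = f (B ∪ X) - f (B ∪ X) / k := by ring
  linarith

/-! ### Local search -/

/-- Queries all the sets of the list and returns a best one together with its value. The result for
the empty list is irrelevant. -/
noncomputable def best {N : Type} : List (Finset N) → OracleProg N (Finset N × ℝ)
  | [] => pure (∅, 0)
  | [S] => query S fun r => pure (S, r)
  | S :: T :: l => query S fun r => (best (T :: l)).bind fun p =>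
      pure (if p.2 ≤ r then (S, r) else p)

theorem always_best {N : Type} {f : Finset N → ℝ} (l : List (Finset N)) (hl : l ≠ []) :
    Always f (fun p => p.1 ∈ l ∧ p.2 = f p.1 ∧ ∀ S ∈ l, f S ≤ p.2) (best l) := by
  induction l with
  | nil => exact absurd rfl hl
  | cons S l ih =>
    cases l with
    | nil => simp [best, Always]
    | cons T l =>
      rw [best, Always, always_bind]
      refine (ih (by simp)).mono fun p hp => ?_
      simp only [Always]
      split_ifs with h
      · refine ⟨by simp, rfl, fun S' hS' => ?_⟩
        rcases List.mem_cons.1 hS' with rfl | hS'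
        · exact le_rfl
        · exact (hp.2.2 _ hS').trans h
      · refine ⟨List.mem_cons_of_mem _ hp.1, hp.2.1, fun S' hS' => ?_⟩
        rcases List.mem_cons.1 hS' with rfl | hS'
        · exact (not_le.1 h).le
        · exact hp.2.2 _ hS'

theorem cost_best_le {N : Type} {f : Finset N → ℝ} (l : List (Finset N)) :
    cost f (best l) ≤ l.length := by
  induction l with
  | nil => simp [best, cost]
  | cons S l ih =>
    cases l with
    | nil => simp [best, cost]
    | cons T l =>
      simp only [best, cost]
      exact Nat.succ_le_succ (cost_bind_le (c := 0) ih (always_of_forall (fun _ => le_rfl) _))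

/-- The sets among which a local search step looks for the set to extend: those obtained from `S` by
removing an element, and `S` itself if there is room for another element. -/
noncomputable def bases (k : ℕ) (S : Finset (Fin (m + 1))) : List (Finset (Fin (m + 1))) :=
  (if S.card < k then [S] else []) ++ S.toList.map S.erase

theorem mem_bases {S B : Finset (Fin (m + 1))} :
    B ∈ bases k S ↔ (S.card < k ∧ B = S) ∨ ∃ v ∈ S, S.erase v = B := by
  unfold bases
  split_ifs with h <;> simp [h]

theorem bases_ne_nil (hk : 0 < k) (S : Finset (Fin (m + 1))) : bases k S ≠ [] := by
  by_cases h : S.card < k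
  · exact List.ne_nil_of_mem (mem_bases.2 (Or.inl ⟨h, rfl⟩))
  · obtain ⟨v, hv⟩ := Finset.card_pos.1 (hk.trans_le (not_lt.1 h))
    exact List.ne_nil_of_mem (mem_bases.2 (Or.inr ⟨v, hv, rfl⟩))

theorem length_bases_le {S : Finset (Fin (m + 1))} (hS : S.card ≤ k) :
    (bases k S).length ≤ k := by
  unfold bases
  split_ifs with h
  · simp; omega
  · simpa using hS

/-- One step of the local search: a best base of `S` is extended, unless this does not improve on
both `S` and the base. -/
noncomputable def localStep (k s d : ℕ) (S : Finset (Fin (m + 1))) :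
    OracleProg (Fin (m + 1)) (Finset (Fin (m + 1))) :=
  query S fun r => (best (bases k S)).bind fun p =>
    if p.2 ≤ r then extend ∅ p.1 r S s d else extend ∅ p.1 p.2 p.1 s d

theorem card_lt_of_mem_bases {S B : Finset (Fin (m + 1))} (hS : S.card ≤ k) (hB : B ∈ bases k S) :
    B.card < k := by
  rcases mem_bases.1 hB with ⟨h, rfl⟩ | ⟨v, hv, rfl⟩
  · exact h
  · exact (Finset.card_erase_lt_of_mem hv).trans_le hS

theorem subset_of_mem_bases {S B : Finset (Fin (m + 1))} (hB : B ∈ bases k S) : B ⊆ S := by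
  rcases mem_bases.1 hB with ⟨h, rfl⟩ | ⟨v, hv, rfl⟩
  · exact subset_rfl
  · exact Finset.erase_subset _ _

theorem always_localStep (hk : 0 < k) {S : Finset (Fin (m + 1))} (hS : S.card ≤ k) :
    Always f (fun A => A.card ≤ k) (localStep k s d S) := by
  rw [localStep, Always, always_bind]
  refine (always_best _ (bases_ne_nil hk S)).mono fun p hp => ?_
  have hc := card_lt_of_mem_bases hS hp.1
  split_ifs
  · refine (always_extend _ _ _ _).mono fun A hA => ?_
    rcases hA with rfl | ⟨u, -, rfl⟩
    · exact hS
    · exact (Finset.card_insert_le _ _).trans hc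
  · refine (always_extend _ _ _ _).mono fun A hA => ?_
    rcases hA with rfl | ⟨u, -, rfl⟩
    · exact hc.le
    · exact (Finset.card_insert_le _ _).trans hc

theorem cost_localStep_le {S : Finset (Fin (m + 1))} (hS : S.card ≤ k) :
    cost f (localStep k s d S) ≤ k + s + 1 := by
  refine Nat.succ_le_succ (cost_bind_le ((cost_best_le _).trans (length_bases_le hS))
    (always_of_forall (fun p => ?_) _))
  split_ifs <;> exact cost_extend_le _ _ _ _

/-- The expected progress of a local search step, which is large unless `S` is close to satisfying
`2 * f S ≥ f (S ∪ O) + f (S ∩ O)` and `f S ≥ f (S ∩ O)`. -/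
theorem le_ev_localStep (h : SampleBounds m k s d η) (hf : IsSubmodular f)
    {S O : Finset (Fin (m + 1))} (hS : S.card ≤ k) (hO : O.card ≤ k) :
    f S + η / k * (f (S ∪ O) + f (S ∩ O) - 2 * f S) ≤ ev f (localStep k s d S) f ∧
      f S + η / k * (f (S ∩ O) - f S) ≤ ev f (localStep k s d S) f := by
  have hk : (0 : ℝ) < k := by exact_mod_cast h.pos
  have hηk : 0 ≤ η / k := div_nonneg h.eta_pos.le hk.le
  have hOS : (O \ S).card ≤ k := (Finset.card_le_card Finset.sdiff_subset).trans hO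
  rw [localStep, ev, ev_bind]
  refine ⟨?_, ?_⟩ <;>
  · rw [← ev_const (f := f) (best (bases k S)) (f S + _)]
    refine ev_mono ((always_best _ (bases_ne_nil h.pos S)).mono fun p hp => ?_)
    obtain ⟨hp1, hp2, hp3⟩ := hp
    have hsub := subset_of_mem_bases hp1
    -- every element of `S \ O` loses at least as much as the base does
    have hloss : ((S \ O).card : ℝ) * (f S - p.2) ≤ f S - f (S ∩ O) := by
      have h1 := hf.sum_sub_erase_le S (S \ O) Finset.sdiff_subset
      rw [Finset.sdiff_sdiff_self_left] at h1
      refine le_trans ?_ h1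
      rw [← nsmul_eq_mul]
      refine Finset.card_nsmul_le_sum _ _ _ fun v hv => ?_
      have := hp3 (S.erase v) (mem_bases.2 (Or.inr ⟨v, (Finset.mem_sdiff.1 hv).1, rfl⟩))
      linarith
    have hgain : f (S ∪ O) - f S ≤ ∑ u ∈ O \ S, (f (insert u p.1) - p.2) := by
      refine (hf.union_sub_le_sum S O).trans (Finset.sum_le_sum fun u hu => ?_)
      rw [hp2]
      exact hf _ _ hsub u (Finset.mem_sdiff.1 hu).2
    have hSO : ((S \ O).card : ℝ) ≤ k := by
      exact_mod_cast (Finset.card_le_card Finset.sdiff_subset).trans hS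
    split_ifs with hle
    · have h2 := le_ev_extend h (E := ∅) (B := p.1) (rfl : f S = f S) hOS (by simp)
      have hI : f (S ∩ O) ≤ f S := by
        have : 0 ≤ ((S \ O).card : ℝ) * (f S - p.2) :=
          mul_nonneg (by positivity) (by linarith)
        linarith
      have h3 : 0 ≤ ∑ u ∈ O \ S, max 0 (f (insert u p.1) - f S) :=
        Finset.sum_nonneg fun _ _ => le_max_left _ _
      have h4 : f (S ∪ O) + f (S ∩ O) - 2 * f S ≤
          ∑ u ∈ O \ S, max 0 (f (insert u p.1) - f S) := by
        have h5 : ∑ u ∈ O \ S, (f (insert u p.1) - p.2) - ((O \ S).card : ℝ) * (f S - p.2) ≤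
            ∑ u ∈ O \ S, max 0 (f (insert u p.1) - f S) := by
          rw [← nsmul_eq_mul, ← Finset.sum_const, ← Finset.sum_sub_distrib]
          exact Finset.sum_le_sum fun u _ => le_max_of_le_right (by linarith)
        have h6 : ((O \ S).card : ℝ) * (f S - p.2) ≤ f S - f (S ∩ O) := by
          by_cases hc : S.card < k
          · have : f S = p.2 := le_antisymm (hp3 S (mem_bases.2 (Or.inl ⟨hc, rfl⟩))) hle
            rw [this] at hI ⊢
            simpa using hI
          · have hcard : (O \ S).card ≤ (S \ O).card := by
              have e1 := Finset.card_sdiff_add_card_inter O S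
              have e2 := Finset.card_sdiff_add_card_inter S O
              rw [Finset.inter_comm] at e1
              omega
            have hcard' : ((O \ S).card : ℝ) ≤ (S \ O).card := by exact_mod_cast hcard
            exact (mul_le_mul_of_nonneg_right hcard' (by linarith)).trans hloss
        linarith
      refine le_trans (add_le_add_right (mul_le_mul_of_nonneg_left ?_ hηk) _) h2
      linarith
    · have h2 := le_ev_extend h (E := ∅) (B := p.1) hp2.symm hOS (by simp)
      have h4 : f (S ∪ O) - f S ≤ ∑ u ∈ O \ S, max 0 (f (insert u p.1) - p.2) :=
        hgain.trans (Finset.sum_le_sum fun u _ => le_max_right _ _)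
      have h3 : 0 ≤ ∑ u ∈ O \ S, max 0 (f (insert u p.1) - p.2) :=
        Finset.sum_nonneg fun _ _ => le_max_left _ _
      have h5 : η / k * (f (S ∩ O) - f S) ≤ p.2 - f S := by
        rw [div_mul_eq_mul_div, div_le_iff₀ hk]
        have e1 : f (S ∩ O) - f S ≤ (p.2 - f S) * k := by nlinarith
        have e2 : 0 ≤ (p.2 - f S) * k := mul_nonneg (by linarith) hk.le
        nlinarith [h.eta_pos, h.eta_le, mul_le_mul_of_nonneg_left e1 h.eta_pos.le,
          mul_le_mul_of_nonneg_right h.eta_le e2]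
      have h6 := mul_le_mul_of_nonneg_left h4 hηk
      have h7 := mul_le_mul_of_nonneg_left h3 hηk
      nlinarith

/-- The local search after `j` steps. -/
noncomputable def localSearch (m k s d : ℕ) :
    ℕ → OracleProg (Fin (m + 1)) (Finset (Fin (m + 1)))
  | 0 => pure ∅
  | j + 1 => (localSearch m k s d j).bind (localStep k s d)

theorem always_localSearch (hk : 0 < k) (j : ℕ) :
    Always f (fun A => A.card ≤ k) (localSearch m k s d j) := by
  induction j with
  | zero => simp [localSearch, Always]
  | succ j ih =>
    rw [localSearch, always_bind]
    exact ih.mono fun A hA => always_localStep hk hA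

theorem cost_localSearch_le (hk : 0 < k) (j : ℕ) :
    cost f (localSearch m k s d j) ≤ j * (k + s + 1) := by
  induction j with
  | zero => simp [localSearch, cost]
  | succ j ih =>
    rw [Nat.succ_mul]
    exact cost_bind_le ih ((always_localSearch hk j).mono fun A hA => cost_localStep_le hA)

/-- The local search stopped after a random number of at most `L` steps. -/
noncomputable def randomLocalSearch (m k s d L : ℕ) :
    OracleProg (Fin (m + 1)) (Finset (Fin (m + 1))) :=
  draw L fun j => localSearch m k s d j

theorem always_randomLocalSearch (hk : 0 < k) (L : ℕ) :
    Always f (fun A => A.card ≤ k) (randomLocalSearch m k s d L) :=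
  fun j => always_localSearch hk j

theorem cost_randomLocalSearch_le (hk : 0 < k) (L : ℕ) :
    cost f (randomLocalSearch m k s d L) ≤ L * (k + s + 1) := by
  refine Finset.sup_le fun j _ => (cost_localSearch_le hk j).trans ?_
  exact Nat.mul_le_mul_right _ (Nat.lt_succ_iff.1 j.2)

/-- If each step of the local search gains `ψ S` in expectation, then `ψ` is small on average, as
the total gain is bounded. -/
theorem ev_randomLocalSearch_le (hk : 0 < k) (h0 : ∀ S, 0 ≤ f S) {M : ℝ}
    (hM : ∀ S : Finset (Fin (m + 1)), S.card ≤ k → f S ≤ M) {ψ : Finset (Fin (m + 1)) → ℝ}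
    (hψ : ∀ S : Finset (Fin (m + 1)), S.card ≤ k → f S + ψ S ≤ ev f (localStep k s d S) f)
    (L : ℕ) : ev f (randomLocalSearch m k s d L) ψ ≤ M / (L + 1) := by
  refine div_le_div_of_nonneg_right ?_ (by positivity)
  have key : ∀ j : ℕ, ∑ i ∈ Finset.range j, ev f (localSearch m k s d i) ψ ≤
      ev f (localSearch m k s d j) f := by
    intro j
    induction j with
    | zero => simpa [localSearch, ev] using h0 ∅
    | succ j ih =>
      rw [Finset.sum_range_succ, localSearch, ev_bind]
      have := ev_mono ((always_localSearch (f := f) (m := m) (s := s) (d := d) hk j).mono hψ)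
      rw [ev_add] at this
      linarith
  rw [Fin.sum_univ_eq_sum_range fun j => ev f (localSearch m k s d j) ψ]
  refine (key _).trans ?_
  rw [← ev_const (f := f) (localSearch m k s d (L + 1)) M]
  exact ev_mono ((always_localSearch hk _).mono hM)

/-! ### Greedy that avoids a set in its first steps -/

/-- `i` steps of the random greedy algorithm, the first `t` of which only use elements outside
of `Z`. -/
noncomputable def greedy (s d : ℕ) (Z : Finset (Fin (m + 1))) (t : ℕ) :
    ℕ → OracleProg (Fin (m + 1)) (Finset (Fin (m + 1)))
  | 0 => pure ∅
  | i + 1 => (greedy s d Z t i).bind fun A => query A fun b =>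
      extend (if i < t then Z else ∅) A b A s d

variable {Z : Finset (Fin (m + 1))} {t : ℕ}

theorem always_greedy (i : ℕ) :
    Always f (fun A => A.card ≤ i ∧ (i ≤ t → Disjoint A Z)) (greedy s d Z t i) := by
  induction i with
  | zero => simp [greedy, Always]
  | succ i ih =>
    rw [greedy, always_bind]
    refine ih.mono fun A hA => ?_
    refine (always_extend _ _ _ _).mono fun A' hA' => ?_
    rcases hA' with rfl | ⟨u, hu, rfl⟩
    · exact ⟨hA.1.trans (Nat.le_succ _), fun h => hA.2 (by omega)⟩
    · refine ⟨(Finset.card_insert_le _ _).trans (Nat.succ_le_succ hA.1), fun h => ?_⟩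
      rw [if_pos (by omega)] at hu
      exact Finset.disjoint_insert_left.2 ⟨hu, hA.2 (by omega)⟩

theorem cost_greedy_le (i : ℕ) : cost f (greedy s d Z t i) ≤ i * (s + 1) := by
  induction i with
  | zero => simp [greedy, cost]
  | succ i ih =>
    rw [Nat.succ_mul]
    exact cost_bind_le ih (always_of_forall (fun A => Nat.succ_le_succ (cost_extend_le _ _ _ _)) _)

theorem le_ev_greedy_union (h : SampleBounds m k s d η) (hf : IsSubmodular f) (h0 : ∀ S, 0 ≤ f S)
    (X : Finset (Fin (m + 1))) (j i : ℕ) :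
    (1 - 1 / (k : ℝ)) ^ i * ev f (greedy s d Z t j) (fun A => f (A ∪ X)) ≤
      ev f (greedy s d Z t (j + i)) fun A => f (A ∪ X) := by
  have hk : (1 : ℝ) ≤ k := by exact_mod_cast h.pos
  have ha : 0 ≤ 1 - 1 / (k : ℝ) := by
    rw [sub_nonneg]; exact (div_le_one (by linarith)).2 hk
  induction i with
  | zero => simp
  | succ i ih =>
    rw [← Nat.add_assoc, greedy, ev_bind, pow_succ']
    have h1 := mul_le_mul_of_nonneg_left ih ha
    rw [mul_assoc]
    refine h1.trans ?_
    rw [← ev_const_mul]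
    exact ev_mono (always_of_forall (fun A => le_ev_extend_union h hf h0 _ A X _) _)

theorem le_ev_greedy_succ (h : SampleBounds m k s d η) (hf : IsSubmodular f)
    {T : Finset (Fin (m + 1))} (hT : T.card ≤ k) (i : ℕ) (hTZ : i < t → Disjoint T Z) :
    ev f (greedy s d Z t i) f +
        η / k * (ev f (greedy s d Z t i) (fun A => f (A ∪ T)) - ev f (greedy s d Z t i) f) ≤
      ev f (greedy s d Z t (i + 1)) f := by
  have hηk : 0 ≤ η / k := div_nonneg h.eta_pos.le (Nat.cast_nonneg k)
  rw [greedy, ev_bind, ← ev_sub, ← ev_const_mul, ← ev_add]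
  refine ev_mono (always_of_forall (fun A => ?_) _)
  have h1 := le_ev_extend h (E := if i < t then Z else ∅) (B := A) (rfl : f A = f A) hT
    (by split_ifs with hi; exacts [hTZ hi, Finset.disjoint_empty_right _])
  refine le_trans (add_le_add_right (mul_le_mul_of_nonneg_left ?_ hηk) _) h1
  refine (hf.union_sub_le_sum A T).trans ?_
  refine (Finset.sum_le_sum fun u _ => le_max_right 0 _).trans ?_
  exact Finset.sum_le_sum_of_subset_of_nonneg Finset.sdiff_subset fun _ _ _ => le_max_left _ _

/-- As long as the greedy algorithm avoids `Z`, its union with a part `Y` of `O` that contains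
`O \ Z` loses only a fraction of `f (O ∪ Z)`. -/
theorem le_ev_greedy_union_of_le (h : SampleBounds m k s d η) (hf : IsSubmodular f)
    (h0 : ∀ S, 0 ≤ f S) {O Y : Finset (Fin (m + 1))} (hY : Y ⊆ O) (hOY : O \ Z ⊆ Y) {i : ℕ}
    (hi : i ≤ t) :
    f Y - (1 - (1 - 1 / (k : ℝ)) ^ i) * f (O ∪ Z) ≤
      ev f (greedy s d Z t i) fun A => f (A ∪ Y) := by
  have h1 := le_ev_greedy_union (Z := Z) (t := t) h hf h0 (O ∪ Z) 0 i
  simp only [greedy, ev, Finset.empty_union, Nat.zero_add] at h1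
  have h2 : ev f (greedy s d Z t i) (fun A => f (A ∪ (O ∪ Z)) + (f Y - f (O ∪ Z))) ≤
      ev f (greedy s d Z t i) fun A => f (A ∪ Y) := by
    refine ev_mono ((always_greedy i).mono fun A hA => ?_)
    have hAZ := Finset.disjoint_left.1 (hA.2 hi)
    have h3 := hf.union_add_inter_le (A ∪ Y) (O ∪ Z)
    have e1 : A ∪ Y ∪ (O ∪ Z) = A ∪ (O ∪ Z) := by
      ext x
      have := @hY x
      simp only [Finset.mem_union]
      tauto
    have e2 : (A ∪ Y) ∩ (O ∪ Z) = Y := by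
      ext x
      have h4 := @hY x
      have h5 := @hOY x
      have h6 := @hAZ x
      simp only [Finset.mem_union, Finset.mem_inter, Finset.mem_sdiff] at h5 ⊢
      tauto
    rw [e1, e2] at h3
    linarith
  rw [ev_add, ev_const] at h2
  linarith

/-- The guarantee of the greedy algorithm. With `D i` the guaranteed value of
`A ∪ (O \ Z)` (in the first `t` steps) or `A ∪ O` (afterwards), the expected values `F i` satisfy
`F (i + 1) ≥ a * F i + η / k * D i`; the left hand side is `η` times the solution of this recursion
for `η = 1`, with `f (O \ Z)` bounded by `f O - f (Z ∩ O)`. -/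
theorem le_ev_greedy (h : SampleBounds m k s d η) (hf : IsSubmodular f) (h0 : ∀ S, 0 ≤ f S)
    {O : Finset (Fin (m + 1))} (hO : O.card ≤ k) (ht : t ≤ k) {a : ℝ} (ha : a = 1 - 1 / (k : ℝ)) :
    η * (a ^ (k - t) * ((1 - a ^ t) * (f O - f (Z ∩ O) - f (Z ∪ O)) +
        t / k * a ^ (t - 1) * f (Z ∪ O)) +
      ((k - t : ℕ) : ℝ) / k * a ^ (k - t - 1) * (f O - (1 - a ^ t) * f (Z ∪ O))) ≤
      ev f (greedy s d Z t k) f := by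
  have hk : (1 : ℝ) ≤ k := by exact_mod_cast h.pos
  have hk0 : (0 : ℝ) < k := by linarith
  have ha0 : 0 ≤ a := by
    rw [ha, sub_nonneg]; exact (div_le_one (by linarith)).2 hk
  have ha1 : a ≤ 1 := by
    rw [ha]
    have : 0 ≤ 1 / (k : ℝ) := by positivity
    linarith
  have hηk : 0 ≤ η / k := div_nonneg h.eta_pos.le hk0.le
  have hF : ∀ i, 0 ≤ ev f (greedy s d Z t i) f := fun i => ev_nonneg h0
  have hstep : ∀ (i : ℕ) (T : Finset (Fin (m + 1))) (D : ℝ), T.card ≤ k →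
      (i < t → Disjoint T Z) → D ≤ ev f (greedy s d Z t i) (fun A => f (A ∪ T)) →
      a * ev f (greedy s d Z t i) f + η / k * D ≤ ev f (greedy s d Z t (i + 1)) f := by
    intro i T D hT hTZ hD
    have h1 := le_ev_greedy_succ h hf hT i hTZ
    have h2 := mul_le_mul_of_nonneg_left hD hηk
    have h3 : η / k * ev f (greedy s d Z t i) f ≤ 1 / k * ev f (greedy s d Z t i) f :=
      mul_le_mul_of_nonneg_right (div_le_div_of_nonneg_right h.eta_le hk0.le) (hF i)
    rw [ha]
    linarith
  have hsplit : f O - f (Z ∩ O) ≤ f (O \ Z) := by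
    have h1 := hf.union_add_inter_le (O \ Z) (Z ∩ O)
    have e1 : O \ Z ∪ Z ∩ O = O := by ext x; by_cases x ∈ Z <;> simp_all
    rw [e1] at h1
    linarith [h0 (O \ Z ∩ (Z ∩ O))]
  rw [Finset.union_comm Z O]
  set U := f (O ∪ Z)
  have hpow : ∀ i : ℕ, a * ((i : ℝ) * a ^ (i - 1)) = i * a ^ i := by
    intro i
    cases i with
    | zero => simp
    | succ i => rw [Nat.add_sub_cancel, pow_succ]; ring
  have hk1 : 1 / (k : ℝ) = 1 - a := by rw [ha]; ring
  have phase1 : ∀ i ≤ t, η * ((1 - a ^ i) * (f O - f (Z ∩ O) - U) + i / k * a ^ (i - 1) * U) ≤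
      ev f (greedy s d Z t i) f := by
    intro i
    induction i with
    | zero => intro _; simpa using hF 0
    | succ i ih =>
      intro hi
      have h1 := hstep i (O \ Z) (f O - f (Z ∩ O) - (1 - a ^ i) * U)
        ((Finset.card_le_card Finset.sdiff_subset).trans hO) (fun _ => Finset.sdiff_disjoint) (by
          have := le_ev_greedy_union_of_le (i := i) h hf h0 (O := O) (Y := O \ Z)
            Finset.sdiff_subset subset_rfl (by omega : i ≤ t)
          rw [← ha] at this
          linarith)
      refine le_trans ?_ h1
      have h2 := mul_le_mul_of_nonneg_left (ih (by omega)) ha0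
      refine le_trans (le_of_eq ?_) (add_le_add_left h2 _)
      rw [Nat.add_sub_cancel, div_eq_mul_one_div η (k : ℝ), hk1, div_eq_mul_one_div (i : ℝ), hk1,
        div_eq_mul_one_div ((i + 1 : ℕ) : ℝ), hk1, pow_succ]
      push_cast
      linear_combination (-η * (1 - a) * U) * hpow i
  have phase2 : ∀ i : ℕ, a ^ i * ev f (greedy s d Z t t) f +
      η * (i / k * a ^ (i - 1) * (f O - (1 - a ^ t) * U)) ≤ ev f (greedy s d Z t (t + i)) f := by
    intro i
    induction i with
    | zero => simp
    | succ i ih =>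
      have h1 := hstep (t + i) O (a ^ i * (f O - (1 - a ^ t) * U)) hO (fun h => by omega) (by
          have e1 := le_ev_greedy_union_of_le (i := t) h hf h0 (O := O) (Y := O)
            subset_rfl Finset.sdiff_subset le_rfl (Z := Z)
          have e2 := le_ev_greedy_union (Z := Z) (t := t) h hf h0 O t i
          rw [← ha] at e1 e2
          exact (mul_le_mul_of_nonneg_left e1 (by positivity)).trans e2)
      refine le_trans ?_ h1
      have h2 := mul_le_mul_of_nonneg_left ih ha0
      refine le_trans (le_of_eq ?_) (add_le_add_left h2 _)
      rw [Nat.add_sub_cancel, div_eq_mul_one_div η (k : ℝ), hk1, div_eq_mul_one_div (i : ℝ), hk1,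
        div_eq_mul_one_div ((i + 1 : ℕ) : ℝ), hk1, pow_succ]
      push_cast
      linear_combination (-η * (1 - a) * (f O - (1 - a ^ t) * U)) * hpow i
  have h1 := phase2 (k - t)
  rw [Nat.add_sub_cancel' ht] at h1
  refine le_trans ?_ h1
  have h2 := mul_le_mul_of_nonneg_left (phase1 t le_rfl) (pow_nonneg ha0 (k - t))
  linarith

end OracleProg

/-! ### The numerical constants -/

/-- `log (1 - h) ≤ - h - h ^ 2 / 2`, in exponential form. -/
theorem one_sub_pow_mul_le {h : ℝ} (h0 : 0 ≤ h) (h1 : h < 1) (t : ℕ) :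
    (1 - h) ^ t ≤ Real.exp (-(t * (h + h ^ 2 / 2))) := by
  have hs := Real.hasSum_pow_div_log_of_abs_lt_one (x := h) (by rwa [abs_of_nonneg h0])
  have h2 := sum_le_hasSum (Finset.range 2) (fun i _ => by positivity) hs
  simp only [Finset.sum_range_succ, Finset.sum_range_zero] at h2
  norm_num at h2
  have h3 : 1 - h ≤ Real.exp (-(h + h ^ 2 / 2)) := by
    rw [← Real.log_le_iff_le_exp (by linarith)]
    linarith
  calc (1 - h) ^ t ≤ Real.exp (-(h + h ^ 2 / 2)) ^ t := pow_le_pow_left₀ (by linarith) h3 t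
    _ = _ := by rw [← Real.exp_nat_mul]; congr 1; ring

theorem exp_neg_372_le : Real.exp (-0.372) ≤ 0.68936 := by
  have h := Real.sum_le_exp_of_nonneg (x := 0.372) (by norm_num) 8
  rw [Real.exp_neg, inv_le_comm₀ (Real.exp_pos _) (by norm_num)]
  refine le_trans ?_ h
  norm_num [Finset.sum_range_succ, Nat.factorial]

/-- The choice of the length `t` of the first phase, about `0.372 * k`. The constants are
`0.23 = 1 - 2 * 0.385`, `0.615 = 1 - 0.385` and `0.6616 > 0.385 * (e - 1)`. The right hand side is
about `0.0016` for large `k`; for small `k` the inequality is checked directly. -/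
theorem exists_phase_length (k : ℕ) (hk : 2 ≤ k) : ∃ t : ℕ, t + 1 ≤ k ∧
    0.0012 ≤ 0.23 * (1 - 1 / (k : ℝ)) * (1 - (1 - 1 / (k : ℝ)) ^ t) + 0.615 * (1 - t / k) -
      0.6616 * (1 - 1 / (k : ℝ)) ^ t := by
  rcases Nat.lt_or_ge k 8 with h8 | h8
  · interval_cases k
    · exact ⟨1, by norm_num, by norm_num⟩
    · exact ⟨1, by norm_num, by norm_num⟩
    · exact ⟨1, by norm_num, by norm_num⟩
    · exact ⟨2, by norm_num, by norm_num⟩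
    · exact ⟨2, by norm_num, by norm_num⟩
    · exact ⟨3, by norm_num, by norm_num⟩
  have hk8 : (8 : ℝ) ≤ k := by exact_mod_cast h8
  have hk0 : (0 : ℝ) < k := by linarith
  have hr : (0 : ℝ) ≤ 0.372 * k + 1 / 2 := by positivity
  have h1 := Nat.floor_le hr
  have h2 := Nat.lt_floor_add_one (0.372 * (k : ℝ) + 1 / 2)
  set t := ⌊(0.372 : ℝ) * k + 1 / 2⌋₊
  refine ⟨t, ?_, ?_⟩
  · have : (t : ℝ) + 1 ≤ k := by linarith
    exact_mod_cast this
  set h : ℝ := 1 / (k : ℝ) with hh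
  have hhk : h * k = 1 := by rw [hh]; field_simp
  have hh0 : 0 < h := by positivity
  have hh8 : h ≤ 1 / 8 := by rw [hh]; exact one_div_le_one_div_of_le (by norm_num) hk8
  obtain ⟨e, he⟩ : ∃ e : ℝ, e = t * h - 0.372 := ⟨_, rfl⟩
  have hth : (t : ℝ) / k = 0.372 + e := by rw [he, hh]; ring
  have he1 : e ≤ h / 2 := by nlinarith
  have he2 : -(h / 2) ≤ e := by nlinarith
  -- the exponent `t * (h + h ^ 2 / 2)` is `0.372 + v`
  set v := e + (0.372 + e) * h / 2 with hv
  have hx := one_sub_pow_mul_le hh0.le (by linarith) t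
  have hexp : -((t : ℝ) * (h + h ^ 2 / 2)) = -0.372 + -v := by
    rw [hv]
    linear_combination (1 + h / 2) * he
  rw [hexp, Real.exp_add] at hx
  have hv1 : 0 < 1 + v := by rw [hv]; nlinarith
  have hev : Real.exp (-v) ≤ 1 / (1 + v) := by
    rw [Real.exp_neg, ← one_div]
    exact one_div_le_one_div_of_le hv1 (by linarith [Real.add_one_le_exp v])
  have hX : (1 - h) ^ t * (1 + v) ≤ 0.68936 := by
    have : (1 - h) ^ t ≤ 0.68936 * (1 / (1 + v)) :=
      hx.trans (mul_le_mul exp_neg_372_le hev (Real.exp_pos _).le (by norm_num))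
    rwa [mul_one_div, le_div_iff₀ hv1] at this
  rw [hth]
  generalize (1 - h) ^ t = x at hX
  have hpoly : 0.0012 * (1 + v) ≤ (0.23 * (1 - h) + 0.615 * (1 - (0.372 + e))) * (1 + v) -
      (0.23 * (1 - h) + 0.6616) * 0.68936 := by
    rw [hv]
    have e1 : e ^ 2 ≤ h ^ 2 / 4 := by nlinarith
    have e2 : h ^ 2 ≤ h / 8 := by nlinarith
    have e3 : e * h ≤ h ^ 2 / 2 := by nlinarith
    have e4 : -(h ^ 2 / 2) ≤ e * h := by nlinarith
    have e5 : e ^ 2 * h ≤ h ^ 2 / 4 * h := mul_le_mul_of_nonneg_right e1 hh0.le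
    have e6 : h ^ 2 * h ≤ h ^ 2 * (1 / 8) := mul_le_mul_of_nonneg_left hh8 (sq_nonneg h)
    have e7 : e * h * h ≤ h ^ 2 / 2 * h := mul_le_mul_of_nonneg_right e3 hh0.le
    have e8 : -(h ^ 2 / 2) * h ≤ e * h * h := mul_le_mul_of_nonneg_right e4 hh0.le
    linarith
  have h3 : (0.23 * (1 - h) + 0.6616) * (x * (1 + v)) ≤ (0.23 * (1 - h) + 0.6616) * 0.68936 :=
    mul_le_mul_of_nonneg_left hX (by linarith)
  by_contra hcon
  linarith [mul_lt_mul_of_pos_right (not_le.1 hcon) hv1]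

/-- `(1 - 1 / k) ^ (k - 1)` is at least `1 / e`. -/
theorem one_le_pow_mul_exp_one {k : ℕ} (hk : 2 ≤ k) :
    1 ≤ (1 - 1 / (k : ℝ)) ^ (k - 1) * Real.exp 1 := by
  obtain ⟨n, rfl⟩ : ∃ n, k = n + 2 := ⟨k - 2, by omega⟩
  have hn : (0 : ℝ) < n + 1 := by positivity
  have h1 : (1 - 1 / ((n + 2 : ℕ) : ℝ)) * (1 / ((n : ℝ) + 1) + 1) = 1 := by
    push_cast
    field_simp
    ring
  have h0 : 0 ≤ 1 - 1 / ((n + 2 : ℕ) : ℝ) := by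
    rw [sub_nonneg, div_le_one (by positivity)]
    push_cast
    linarith
  have h2 : (1 / ((n : ℝ) + 1) + 1) ^ (n + 1) ≤ Real.exp 1 := by
    calc (1 / ((n : ℝ) + 1) + 1) ^ (n + 1) ≤ Real.exp (1 / ((n : ℝ) + 1)) ^ (n + 1) :=
          pow_le_pow_left₀ (by positivity) (Real.add_one_le_exp _) _
      _ = Real.exp 1 := by
          rw [← Real.exp_nat_mul]
          congr 1
          push_cast
          field_simp
  rw [show n + 2 - 1 = n + 1 by omega]
  calc (1 : ℝ) = (1 - 1 / ((n + 2 : ℕ) : ℝ)) ^ (n + 1) * (1 / ((n : ℝ) + 1) + 1) ^ (n + 1) := by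
        rw [← mul_pow, h1, one_pow]
    _ ≤ _ := mul_le_mul_of_nonneg_left h2 (pow_nonneg h0 _)

/-- For a suitable length `t` of the first phase, the guarantee of the greedy algorithm, in terms
of `v = f O`, `i = f (Z ∩ O)` and `u = f (Z ∪ O)`, is `cO * v - cI * i - cU * u`, where combining it
with `2 * f Z ≥ i + u` (with weight `cU`) and `f Z ≥ i` (with weight `cI - cU`) gives the ratio
`cO / (1 + cI + cU) > 0.385`. -/
theorem exists_phase_length_coeffs (k : ℕ) (hk : 1 ≤ k) : ∃ t ≤ k, ∃ cO cI cU : ℝ,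
    0 ≤ cU ∧ cU ≤ cI ∧ cI ≤ 1 ∧ 0.385 * (1 + cI + cU) + 0.0004 ≤ cO ∧
    ∀ a v i u : ℝ, a = 1 - 1 / (k : ℝ) →
      a ^ (k - t) * ((1 - a ^ t) * (v - i - u) + t / k * a ^ (t - 1) * u) +
        ((k - t : ℕ) : ℝ) / k * a ^ (k - t - 1) * (v - (1 - a ^ t) * u) =
      cO * v - cI * i - cU * u := by
  rcases hk.eq_or_lt with rfl | hk2
  · exact ⟨0, by norm_num, 1, 0, 0, by norm_num, by norm_num, by norm_num, by norm_num,
      fun a v i u ha => by simp⟩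
  obtain ⟨t, htk, hH⟩ := exists_phase_length k hk2
  have hk0 : (0 : ℝ) < k := by positivity
  have hk2' : (2 : ℝ) ≤ k := by exact_mod_cast hk2
  have hq := one_le_pow_mul_exp_one hk2
  have hinv : 1 / (k : ℝ) ≤ 1 / 2 := one_div_le_one_div_of_le (by norm_num) hk2'
  have hinv0 : 0 < 1 / (k : ℝ) := by positivity
  have hber := one_add_mul_le_pow (a := -(1 / (k : ℝ))) (by linarith) t
  have hexp : (1 - 1 / (k : ℝ)) ^ t * (1 + t / k) ≤ 1 := by
    have h1 : 1 - 1 / (k : ℝ) ≤ Real.exp (-(1 / (k : ℝ))) := Real.one_sub_le_exp_neg _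
    have h2 : (1 - 1 / (k : ℝ)) ^ t ≤ Real.exp (-(t / k)) := by
      refine (pow_le_pow_left₀ (by linarith) h1 t).trans (le_of_eq ?_)
      rw [← Real.exp_nat_mul]
      congr 1
      ring
    have h3 : 1 + (t : ℝ) / k ≤ Real.exp (t / k) := by
      linarith [Real.add_one_le_exp ((t : ℝ) / k)]
    calc _ ≤ Real.exp (-(t / k)) * Real.exp (t / k) :=
          mul_le_mul h2 h3 (by positivity) (Real.exp_pos _).le
      _ = 1 := by rw [← Real.exp_add]; simp
  rw [← sub_eq_add_neg] at hber
  have hτ : (t : ℝ) / k ≤ 1 - 1 / k := by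
    rw [div_le_iff₀ hk0, sub_mul, one_div, inv_mul_cancel₀ hk0.ne']
    have : (t : ℝ) + 1 ≤ k := by exact_mod_cast htk
    linarith
  have hτ0 : 0 ≤ (t : ℝ) / k := by positivity
  have hkt : ((k - t : ℕ) : ℝ) / k = 1 - t / k := by
    rw [Nat.cast_sub (by omega), sub_div, div_self hk0.ne']
  have hber' : 1 - (t : ℝ) / k ≤ (1 - 1 / (k : ℝ)) ^ t := by
    refine le_trans (le_of_eq ?_) hber
    ring
  obtain ⟨a, ha⟩ : ∃ a : ℝ, a = 1 - 1 / (k : ℝ) := ⟨_, rfl⟩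
  rw [← ha] at hH hq hexp hτ hber'
  have ha0 : 0 < a := by linarith
  have ha1 : a ≤ 1 := by linarith
  have hr : a ^ (k - t) = a * a ^ (k - t - 1) := by
    rw [← pow_succ']
    congr 1
    omega
  have hrx : a ^ (k - 1) = a ^ (k - t - 1) * a ^ t := by
    rw [← pow_add]
    congr 1
    omega
  have hrt : (t : ℝ) / k * (a * a ^ (t - 1)) = t / k * a ^ t := by
    cases t with
    | zero => simp
    | succ t => rw [Nat.add_sub_cancel, pow_succ']
  have hx1 : a ^ t ≤ 1 := pow_le_one₀ ha0.le ha1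
  have hr1 : a ^ (k - t - 1) ≤ 1 := pow_le_one₀ ha0.le ha1
  have hr0 : 0 < a ^ (k - t - 1) := by positivity
  have hx0 : 0 < a ^ t := by positivity
  refine ⟨t, by omega, a ^ (k - t - 1) * (a * (1 - a ^ t) + (1 - t / k)),
    a ^ (k - t - 1) * (a * (1 - a ^ t)),
    a ^ (k - t - 1) * (a * (1 - a ^ t) - t / k * a ^ t + (1 - t / k) * (1 - a ^ t)),
    ?_, ?_, ?_, ?_, ?_⟩
  · refine mul_nonneg hr0.le ?_
    have h1 : 0 ≤ (1 + t / (k : ℝ)) *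
        (a * (1 - a ^ t) - t / k * a ^ t + (1 - t / k) * (1 - a ^ t)) := by
      nlinarith [mul_le_mul_of_nonneg_right hexp (by linarith : 0 ≤ 1 + a),
        mul_le_mul_of_nonneg_right hτ hτ0]
    exact nonneg_of_mul_nonneg_right h1 (by linarith)
  · refine mul_le_mul_of_nonneg_left ?_ hr0.le
    nlinarith
  · have : a * (1 - a ^ t) ≤ 1 := by nlinarith
    nlinarith
  · rw [hrx] at hq
    generalize a ^ (k - t - 1) = r at *
    generalize a ^ t = x at *
    have he := Real.exp_one_lt_d9
    have h1 : 1 ≤ r * x * 2.7183 := by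
      have := mul_pos hr0 hx0
      nlinarith
    have h2 : 0.36 ≤ r := by nlinarith
    have h3 := mul_le_mul_of_nonneg_left hH hr0.le
    nlinarith
  · intro a' v i u ha'
    obtain rfl : a' = a := by rw [ha', ha]
    rw [hkt, hr]
    linear_combination (a' ^ (k - t - 1) * u) * hrt

/-! ### The algorithm -/

namespace OracleProg

variable {m k s d : ℕ} {η : ℝ} {f : Finset (Fin (m + 1)) → ℝ}

/-- The better one of the result `Z` of the local search and the result of the greedy algorithm
that avoids `Z` in its first `t` steps. -/
noncomputable def aidedGreedy (m k s d L t : ℕ) :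
    OracleProg (Fin (m + 1)) (Finset (Fin (m + 1))) :=
  (randomLocalSearch m k s d L).bind fun Z => (greedy s d Z t k).bind fun A =>
    (best [Z, A]).bind fun p => pure p.1

theorem always_aidedGreedy (hk : 0 < k) (L t : ℕ) :
    Always f (fun A => A.card ≤ k) (aidedGreedy m k s d L t) := by
  rw [aidedGreedy, always_bind]
  refine (always_randomLocalSearch hk L).mono fun Z hZ => ?_
  rw [always_bind]
  refine (always_greedy k).mono fun A hA => ?_
  rw [always_bind]
  refine (always_best [Z, A] (by simp)).mono fun p hp => ?_
  rcases List.mem_pair.1 hp.1 with h | h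
  · exact (congrArg Finset.card h).trans_le hZ
  · exact (congrArg Finset.card h).trans_le hA.1

theorem cost_aidedGreedy_le (hk : 0 < k) (L t : ℕ) :
    cost f (aidedGreedy m k s d L t) ≤ L * (k + s + 1) + (k * (s + 1) + 2) :=
  cost_bind_le (cost_randomLocalSearch_le hk L) (always_of_forall (fun Z =>
    cost_bind_le (cost_greedy_le k) (always_of_forall (fun A =>
      cost_bind_le (c := 0) (cost_best_le [Z, A]) (always_of_forall (fun _ => le_rfl) _)) _)) _)

theorem le_ev_aidedGreedy (h : SampleBounds m k s d η) (hf : IsSubmodular f) (h0 : ∀ S, 0 ≤ f S)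
    (hη : 0.9998 ≤ η) {L : ℕ} (hL : 100000 * k ≤ L) {O : Finset (Fin (m + 1))} (hO : O.card ≤ k)
    (hmax : ∀ S : Finset (Fin (m + 1)), S.card ≤ k → f S ≤ f O) {t : ℕ} (ht : t ≤ k)
    {cO cI cU : ℝ} (hU : 0 ≤ cU) (hUI : cU ≤ cI) (hI : cI ≤ 1)
    (hc : 0.385 * (1 + cI + cU) + 0.0004 ≤ cO)
    (hcoeff : ∀ a v i u : ℝ, a = 1 - 1 / (k : ℝ) →
      a ^ (k - t) * ((1 - a ^ t) * (v - i - u) + t / k * a ^ (t - 1) * u) +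
        ((k - t : ℕ) : ℝ) / k * a ^ (k - t - 1) * (v - (1 - a ^ t) * u) =
      cO * v - cI * i - cU * u) :
    0.385 * f O ≤ ev f (aidedGreedy m k s d L t) f := by
  have hk : (0 : ℝ) < k := by exact_mod_cast h.pos
  have hηk : 0 < η / k := div_pos h.eta_pos hk
  set loc := randomLocalSearch m k s d L with hloc
  set R := ev f (aidedGreedy m k s d L t) f with hR
  have hbest : ∀ Z A : Finset (Fin (m + 1)),
      f Z ≤ ev f ((best [Z, A]).bind fun p => pure p.1) f ∧
        f A ≤ ev f ((best [Z, A]).bind fun p => pure p.1) f := by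
    intro Z A
    rw [ev_bind]
    have hb := always_best (f := f) [Z, A] (by simp)
    constructor
    · rw [← ev_const (f := f) (best [Z, A]) (f Z)]
      exact ev_mono (hb.mono fun p hp => by
        simp only [ev]; rw [← hp.2.1]; exact hp.2.2 Z (by simp))
    · rw [← ev_const (f := f) (best [Z, A]) (f A)]
      exact ev_mono (hb.mono fun p hp => by
        simp only [ev]; rw [← hp.2.1]; exact hp.2.2 A (by simp))
  have hR1 : ev f loc f ≤ R := by
    rw [hR, aidedGreedy, ev_bind]
    refine ev_mono (always_of_forall (fun Z => ?_) _)
    rw [ev_bind, ← ev_const (f := f) (greedy s d Z t k) (f Z)]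
    exact ev_mono (always_of_forall (fun A => (hbest Z A).1) _)
  have hR2 : η * (cO * f O - cI * ev f loc (fun Z => f (Z ∩ O)) -
      cU * ev f loc fun Z => f (Z ∪ O)) ≤ R := by
    have e : ev f loc (fun Z => η * (cO * f O - cI * f (Z ∩ O) - cU * f (Z ∪ O))) =
        η * (cO * f O - cI * ev f loc (fun Z => f (Z ∩ O)) -
          cU * ev f loc fun Z => f (Z ∪ O)) := by
      rw [ev_const_mul, ev_sub, ev_const_sub, ev_const_mul, ev_const_mul]
    rw [← e, hR, aidedGreedy, ev_bind]
    refine ev_mono (always_of_forall (fun Z => ?_) _)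
    rw [ev_bind, ← hcoeff _ _ _ _ rfl]
    refine (le_ev_greedy h hf h0 hO ht rfl).trans ?_
    exact ev_mono (always_of_forall (fun A => (hbest Z A).2) _)
  -- the average violation of the two conditions of local optimality is at most `0.00002 * f O`
  have herr : ∀ ψ : Finset (Fin (m + 1)) → ℝ,
      (∀ S : Finset (Fin (m + 1)), S.card ≤ k →
        f S + η / k * ψ S ≤ ev f (localStep k s d S) f) → ev f loc ψ ≤ 0.00002 * f O := by
    intro ψ hψ
    have h1 := ev_randomLocalSearch_le (ψ := fun S => η / k * ψ S) h.pos h0 hmax hψ L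
    rw [ev_const_mul, ← hloc, le_div_iff₀ (by positivity), div_mul_eq_mul_div, div_mul_eq_mul_div,
      div_le_iff₀ hk] at h1
    have hL' : 100000 * (k : ℝ) ≤ L := by exact_mod_cast hL
    by_contra hcon
    rw [not_le] at hcon
    have h2 : 0 ≤ 0.00002 * f O := by linarith [h0 O]
    have h3 : 0 < ev f loc ψ := h2.trans_lt hcon
    have h4 : 50000 * (k : ℝ) * ev f loc ψ ≤ η * ev f loc ψ * (L + 1) := by
      have : 50000 * (k : ℝ) ≤ η * (L + 1) := by nlinarith
      nlinarith
    have h5 := mul_lt_mul_of_pos_left hcon hk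
    linarith
  have he1 := herr (fun S => f (S ∪ O) + f (S ∩ O) - 2 * f S)
    fun S hS => (le_ev_localStep h hf hS hO).1
  have he2 := herr (fun S => f (S ∩ O) - f S) fun S hS => (le_ev_localStep h hf hS hO).2
  rw [ev_sub, ev_add, ev_const_mul] at he1
  rw [ev_sub] at he2
  generalize ev f loc (fun Z => f (Z ∩ O)) = i at *
  generalize ev f loc (fun Z => f (Z ∪ O)) = u at *
  generalize (ev f loc fun Z => f Z) = z at *
  have hv := h0 O
  generalize f O = v at *
  have h1 : η * (cU * (u + i - 0.00002 * v)) ≤ η * (cU * (2 * R)) :=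
    mul_le_mul_of_nonneg_left (mul_le_mul_of_nonneg_left (by linarith) hU) h.eta_pos.le
  have h2 : η * ((cI - cU) * (i - 0.00002 * v)) ≤ η * ((cI - cU) * R) :=
    mul_le_mul_of_nonneg_left
      (mul_le_mul_of_nonneg_left (by linarith) (by linarith)) h.eta_pos.le
  have h3 : η * (cO - 0.00002 * cI) * v ≤ (1 + η * (cI + cU)) * R := by linarith
  have h4 : 0.385 * (1 + η * (cI + cU)) ≤ η * (cO - 0.00002 * cI) := by
    have : η * (0.385 * (1 + cI + cU) + 0.00038) ≤ η * (cO - 0.00002 * cI) :=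
      mul_le_mul_of_nonneg_left (by linarith) h.eta_pos.le
    linarith
  have h5 : 0 < 1 + η * (cI + cU) := by
    have : 0 ≤ η * (cI + cU) := mul_nonneg h.eta_pos.le (by linarith)
    linarith
  have h6 := (mul_le_mul_of_nonneg_right h4 hv).trans h3
  refine le_of_mul_le_mul_left ?_ h5
  linarith

end OracleProg

/-- The algorithm, for a choice `t k` of the length of the first greedy phase. A bound `k` that
exceeds the size of the ground set is replaced by this size. -/
noncomputable def aidedGreedyAlg (t : ℕ → ℕ) : (n k : ℕ) → QueryAlgorithm (Fin n)
  | 0, _ => .output ∅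
  | m + 1, k => (OracleProg.aidedGreedy m (min k (m + 1))
      (100000000 * (m + 1) / min k (m + 1)) 99999999 (100000 * min k (m + 1))
      (t (min k (m + 1)))).toAlg

/-- The sampling parameters of the algorithm. In the bound on the loss, `δ = 5000` is half the square
root of `d + 1`, which is the best choice. -/
theorem sampleBounds_const {m k : ℕ} (hk : 0 < k) (hkm : k ≤ m + 1) :
    SampleBounds m k (100000000 * (m + 1) / k) 99999999 0.9998 where
  pos := hk
  le_ground := hkm
  mul_le := Nat.div_mul_le_self _ _
  le_mul := by
    have h1 := Nat.div_add_mod (100000000 * (m + 1)) k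
    have h2 := Nat.mod_lt (100000000 * (m + 1)) hk
    rw [mul_comm] at h1
    omega
  loss := ⟨5000, by norm_num, by norm_num⟩
  eta_pos := by norm_num
  eta_le := by norm_num

theorem mainTheorem1 :
    ∃ (C : ℕ) (alg : (n k : ℕ) → QueryAlgorithm (Fin n)),
      ∀ (n k : ℕ), 1 ≤ k →
        ∀ f : Finset (Fin n) → ℝ, (∀ S, 0 ≤ f S) → IsSubmodular f →
          (∀ T, (alg n k).CanOutput f T → T.card ≤ k) ∧
          (0.385 : ℝ) * cardOpt f k ≤ (alg n k).expectedValue f ∧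
          (alg n k).numQueries f ≤ C * (n + k ^ 2) := by
  choose! t ht using exists_phase_length_coeffs
  refine ⟨100000000000000, aidedGreedyAlg t, fun n k hk f h0 hf => ?_⟩
  obtain ⟨O, hO, hopt⟩ := Finset.exists_mem_eq_sup'
    (⟨∅, by simp⟩ : (Finset.univ.filter fun S : Finset (Fin n) => S.card ≤ k).Nonempty) f
  have hOk : O.card ≤ k := (Finset.mem_filter.1 hO).2
  have hcard : cardOpt f k = f O := hopt
  have hmax : ∀ S : Finset (Fin n), S.card ≤ k → f S ≤ f O := fun S hS => by
    rw [← hcard]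
    exact Finset.le_sup' f (Finset.mem_filter.2 ⟨Finset.mem_univ _, hS⟩)
  rw [hcard]
  cases n with
  | zero =>
    obtain rfl : O = ∅ := Subsingleton.elim _ _
    refine ⟨fun T hT => ?_, ?_, ?_⟩
    · rw [show T = ∅ from hT]
      simp
    · change _ ≤ f ∅
      linarith [h0 ∅]
    · exact Nat.zero_le _
  | succ m =>
    have hj : 0 < min k (m + 1) := by omega
    have hjk : min k (m + 1) ≤ k := min_le_left _ _
    have hjm : min k (m + 1) ≤ m + 1 := min_le_right _ _
    have hOj : O.card ≤ min k (m + 1) :=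
      le_min hOk (by simpa using Finset.card_le_univ O)
    simp only [aidedGreedyAlg]
    generalize min k (m + 1) = j at *
    have hsb := sampleBounds_const hj hjm
    obtain ⟨htj, cO, cI, cU, hU, hUI, hI, hc, hcoeff⟩ := ht j hj
    refine ⟨fun T hT => ?_, ?_, ?_⟩
    · exact ((OracleProg.always_aidedGreedy hj _ _).of_canOutput_toAlg hT).trans hjk
    · rw [OracleProg.expectedValue_toAlg]
      exact OracleProg.le_ev_aidedGreedy hsb hf h0 le_rfl le_rfl hOj
        (fun S hS => hmax S (hS.trans hjk)) htj hU hUI hI hc hcoeff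
    · rw [OracleProg.numQueries_toAlg]
      refine (OracleProg.cost_aidedGreedy_le hj _ _).trans ?_
      have hs := hsb.mul_le
      have hj2 : j ^ 2 ≤ k ^ 2 := Nat.pow_le_pow_left hjk 2
      have hj3 : j ≤ j ^ 2 := Nat.le_self_pow (by norm_num) j
      generalize 100000000 * (m + 1) / j = s at *
      have e : 100000 * j * (j + s + 1) + (j * (s + 1) + 2) =
          100000 * j ^ 2 + 100001 * (s * j) + 100001 * j + 2 := by ring
      rw [e]
      omega
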